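/- Let $F$ be an algebraically closed field of characteristic zero, and let $e_{ij}$ ($1\le i,j\le 3$) be the matrix units of $M_3(F)$. A linear operator $R$ on an $F$-algebra $A$ is a Rota–Baxter operator (RB-operator) of weight $1$ if $R(x)R(y)=R(R(x)y+xR(y)+xy)$ for all $x,y\in A$. Put $\phi(R)=R'=-R-\mathrm{id}$, and let $T$ denote transpose. The orbit of an operator $R$ on $M_3(F)$ is its orbit under the group generated by $\phi$, by the conjugations $R\mapsto\psi^{-1}R\psi$ with $\psi\in\mathrm{Aut}(M_3(F))$, and by the conjugation $R\mapsto T\circ R\circ T$. Consider the following 36 linear operators on $M_3(F)$. A) (20 primitive operators) For a linear operator $P$ on the diagonal subalgebra $D_3=Ff_1\oplus Ff_2\oplus Ff_3$, $f_i=e_{ii}$, extend $P$ to $M_3(F)$ by $R|_{D_3}=P$, $R(e_{ij})=0$ for $i<j$, and $R(e_{ij})=-e_{ij}$ for $i>j$. Let $Xa$ be the extension of the following $P$, for $X=1,\dots,7$: 1) $f_1\mapsto f_2+f_3$, $f_2\mapsto f_3$, $f_3\mapsto 0$; 2) $f_1\mapsto f_2+f_3$, $f_2\mapsto f_3$, $f_3\mapsto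 -f_3$; 3) $f_1\mapsto f_2+f_3$, $f_2\mapsto -(f_2+f_3)$, $f_3\mapsto -f_3$; 4) $f_1\mapsto f_2+f_3$, $f_2\mapsto -f_2$, $f_3\mapsto 0$; 5) $f_1\mapsto f_2+f_3$, $f_2\mapsto 0$, $f_3\mapsto 0$; 6) $f_1\mapsto f_2$, $f_2\mapsto 0$, $f_3\mapsto 0$; 7) $f_1\mapsto f_2$, $f_2\mapsto 0$, $f_3\mapsto -f_3$. Let $Xb$ (respectively $Xc$) be the extension of the operator obtained from case $X$ by conjugation with the automorphism of $D_3$ that swaps $f_1,f_2$ (respectively $f_2,f_3$). The list contains all $Xa$, $Xb$, $Xc$, $X=1,\dots,7$, except $5c$. B) The four operators 1-I) $R(e_{11})=e_{22}+e_{33}$, $R(e_{22})=e_{33}$; $e_{31},e_{32},e_{33}\in\ker R$; $e_{12},e_{13}\in\ker R'$; $R(e_{21})=-e_{32}$, $R(e_{23})=e_{12}-e_{23}$; 6-I) $e_{22},e_{23},e_{32},e_{33}\in\ker R$; $R(e_{11})=e_{22}$, $R(e_{12})=-e_{12}-e_{32}$, $R(e_{21})=-e_{21}+e_{23}$, $R(e_{13})=e_{11}+e_{22}-e_{13}$,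 $R(e_{31})=-e_{31}+e_{33}$; 6-II) $e_{12},e_{13},e_{22},e_{23},e_{32},e_{33}\in\ker R$; $R(e_{11})=e_{22}$, $R(e_{21})=-e_{21}$, $R(e_{31})=-e_{31}+e_{11}+e_{22}$; 6-III) $e_{12},e_{13},e_{22},e_{23},e_{32},e_{33}\in\ker R$; $R(e_{11})=e_{22}$, $R(e_{21})=-e_{21}-e_{23}$, $R(e_{31})=-e_{31}+e_{11}+e_{22}$. C) The twelve operators with $e_{12},e_{13}\in\ker R'$, $e_{21},e_{31}\in\ker R$ and 2-I) $R(e_{11})=e_{22}+e_{33}$, $R(e_{22})=e_{33}$; $e_{23},e_{33}\in\ker R'$; $R(e_{32})=e_{33}$; 2-II) $R(e_{11})=e_{22}+e_{33}$, $R(e_{22})=e_{33}$; $e_{32},e_{33}\in\ker R'$; $R(e_{23})=e_{33}$; 3-I) $e_{11},e_{23}\in\ker R'$; $-R(e_{22})=R(e_{33})=R(e_{32})=e_{11}+e_{22}$; 3-II) $e_{11},e_{32}\in\ker R'$; $-R(e_{22})=R(e_{33})=R(e_{23})=e_{11}+e_{22}$; 4-I) $R(e_{22})=e_{11}+e_{33}$;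 $e_{33},e_{32}\in\ker R'$; $e_{11}\in\ker R$; $R(e_{23})=e_{33}$; 4-II) $R(e_{22})=e_{11}+e_{33}$; $e_{33},e_{23}\in\ker R'$; $e_{11}\in\ker R$; $R(e_{32})=e_{33}$; 5-I) $R(e_{11})=e_{22}+e_{33}$; $e_{22},e_{23},e_{32},e_{33}\in\ker R$; 5-II) $R(e_{11})=e_{22}+e_{33}$; $e_{22},e_{23},e_{33}\in\ker R$; $R(e_{32})=e_{33}-e_{32}$; 6-IV) $e_{11},e_{33},e_{32}\in\ker R$; $R(e_{22})=e_{11}$, $R(e_{23})=-e_{23}+e_{11}+e_{22}$; 6-V) $e_{11},e_{33},e_{23}\in\ker R$; $R(e_{22})=e_{11}$, $R(e_{32})=-e_{32}+e_{11}+e_{22}$; 6-VI) $e_{22},e_{33},e_{23},e_{32}\in\ker R$; $R(e_{11})=e_{22}$; 8-I) $e_{11}\in\ker R'$; $e_{22},e_{23},e_{33}\in\ker R$; $R(e_{32})=e_{11}+e_{22}-e_{32}$. Then all 36 operators are RB-operators of weight $1$ on $M_3(F)$, and they lie in pairwise distinct orbits. -/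

import Mathlib

namespace RotaBaxter

/-- `R` is a Rota-Baxter operator of weight `lam` on the `F`-algebra `A`. -/
def IsRotaBaxter {F A : Type*} [Field F] [Ring A] [Algebra F A] (lam : F)
    (R : Module.End F A) : Prop :=
  ∀ x y : A, R x * R y = R (R x * y + x * R y + lam • (x * y))

section Symmetries

variable {F A : Type*} [Field F] [Ring A] [Algebra F A]

/-- The map `φ` for weight `lam`: `φ(P) = -P - lam • id`. -/
def phi (lam : F) (P : Module.End F A) : Module.End F A :=
  -P - lam • LinearMap.id

theorem phi_involutive (lam : F) :
    Function.Involutive (phi (A := A) lam) := by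
  intro P
  simp [phi]

/-- `φ` as a permutation of the set of linear operators. -/
def phiPerm (lam : F) : Equiv.Perm (Module.End F A) :=
  (phi_involutive lam).toPerm

/-- Conjugation with an automorphism `ψ`: `P ↦ ψ⁻¹ P ψ`. -/
def conjPerm (ψ : A ≃ₐ[F] A) : Equiv.Perm (Module.End F A) where
  toFun P := ψ.symm.toLinearMap ∘ₗ P ∘ₗ ψ.toLinearMap
  invFun P := ψ.toLinearMap ∘ₗ P ∘ₗ ψ.symm.toLinearMap
  left_inv P := by ext x; simp
  right_inv P := by ext x; simp

end Symmetries

/-- The algebra `M₃(F)`. -/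
abbrev M3 (F : Type*) : Type _ := Matrix (Fin 3) (Fin 3) F

variable {F : Type*} [Field F]

/-- Conjugation with transpose: `P ↦ T ∘ P ∘ T`, where `T x = xᵀ`. -/
def transposePerm : Equiv.Perm (Module.End F (M3 F)) :=
  Function.Involutive.toPerm
    (fun P => (Matrix.transposeLinearEquiv (Fin 3) (Fin 3) F F).toLinearMap ∘ₗ P ∘ₗ
      (Matrix.transposeLinearEquiv (Fin 3) (Fin 3) F F).toLinearMap)
    (by intro P; ext x; simp)

variable (F) in
/-- The group generated by `φ` (for weight 1), by the conjugations with all automorphisms of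
the `F`-algebra `M₃(F)`, and by the conjugation with transpose. -/
def symmetryGroup : Subgroup (Equiv.Perm (Module.End F (M3 F))) :=
  Subgroup.closure ({phiPerm 1, transposePerm} ∪ Set.range conjPerm)

/-- The orbit of an operator under the group generated by `φ`, conjugations with automorphisms,
and conjugation with transpose. -/
def orbit (R : Module.End F (M3 F)) : Set (Module.End F (M3 F)) :=
  MulAction.orbit (symmetryGroup F) R

/-! The matrix units of `M₃(F)`. -/

/-- Matrix unit. -/
def e11 : M3 F := Matrix.single 0 0 1
/-- Matrix unit. -/
def e12 : M3 F := Matrix.single 0 1 1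
/-- Matrix unit. -/
def e13 : M3 F := Matrix.single 0 2 1
/-- Matrix unit. -/
def e21 : M3 F := Matrix.single 1 0 1
/-- Matrix unit. -/
def e22 : M3 F := Matrix.single 1 1 1
/-- Matrix unit. -/
def e23 : M3 F := Matrix.single 1 2 1
/-- Matrix unit. -/
def e31 : M3 F := Matrix.single 2 0 1
/-- Matrix unit. -/
def e32 : M3 F := Matrix.single 2 1 1
/-- Matrix unit. -/
def e33 : M3 F := Matrix.single 2 2 1

/-- The linear operator on `M₃(F)` that sends the matrix unit `e_{ij}` to the `(i,j)` entry of
the table `t`. -/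
def ofTable (t : Matrix (Fin 3) (Fin 3) (M3 F)) : Module.End F (M3 F) where
  toFun x := ∑ i, ∑ j, x i j • t i j
  map_add' x y := by simp [add_smul, Finset.sum_add_distrib]
  map_smul' c x := by simp [mul_smul, Finset.smul_sum]

/-- The extension to `M₃(F)` of a linear operator `P` on the diagonal subalgebra `F³`:
it is zero on strictly upper triangular matrices, minus the identity on strictly lower triangular
matrices, and `P` on diagonal matrices. -/
def primitive (P : Module.End F (Fin 3 → F)) : Module.End F (M3 F) where
  toFun x := Matrix.diagonal (P x.diag) - Matrix.of (fun i j => if j < i then x i j else 0)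
  map_add' x y := by
    ext i j
    by_cases hij : i = j <;> by_cases hlt : j < i <;>
      simp [Matrix.diagonal_apply, hij, hlt] <;> ring
  map_smul' c x := by
    ext i j
    by_cases hij : i = j <;> by_cases hlt : j < i <;>
      simp [Matrix.diagonal_apply, hij, hlt]

/-- The operator on `F³ = F f₁ ⊕ F f₂ ⊕ F f₃` for which `R(f_i)` is the `i`-th row of `m`. -/
def ofRows (m : Matrix (Fin 3) (Fin 3) F) : Module.End F (Fin 3 → F) :=
  Matrix.vecMulLinear m

/-! The seven operators on `F³`; the `i`-th row of the matrix lists the coordinates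
of `R(f_i)`. -/

/-- `R(f₁) = f₂ + f₃`, `R(f₂) = f₃`, `R(f₃) = 0`. -/
def rows1 : Matrix (Fin 3) (Fin 3) F := !![0, 1, 1; 0, 0, 1; 0, 0, 0]
/-- `R(f₁) = f₂ + f₃`, `R(f₂) = f₃`, `R(f₃) = -f₃`. -/
def rows2 : Matrix (Fin 3) (Fin 3) F := !![0, 1, 1; 0, 0, 1; 0, 0, -1]
/-- `R(f₁) = f₂ + f₃`, `R(f₂) = -(f₂ + f₃)`, `R(f₃) = -f₃`. -/
def rows3 : Matrix (Fin 3) (Fin 3) F := !![0, 1, 1; 0, -1, -1; 0, 0, -1]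
/-- `R(f₁) = f₂ + f₃`, `R(f₂) = -f₂`, `R(f₃) = 0`. -/
def rows4 : Matrix (Fin 3) (Fin 3) F := !![0, 1, 1; 0, -1, 0; 0, 0, 0]
/-- `R(f₁) = f₂ + f₃`, `R(f₂) = 0`, `R(f₃) = 0`. -/
def rows5 : Matrix (Fin 3) (Fin 3) F := !![0, 1, 1; 0, 0, 0; 0, 0, 0]
/-- `R(f₁) = f₂`, `R(f₂) = 0`, `R(f₃) = 0`. -/
def rows6 : Matrix (Fin 3) (Fin 3) F := !![0, 1, 0; 0, 0, 0; 0, 0, 0]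
/-- `R(f₁) = f₂`, `R(f₂) = 0`, `R(f₃) = -f₃`. -/
def rows7 : Matrix (Fin 3) (Fin 3) F := !![0, 1, 0; 0, 0, 0; 0, 0, -1]

/-- The primitive operator of type `a`. -/
def primA (m : Matrix (Fin 3) (Fin 3) F) : Module.End F (M3 F) :=
  primitive (ofRows m)

/-- The primitive operator of type `b`: the diagonal action is conjugated with the
transposition of the first two coordinates. -/
def primB (m : Matrix (Fin 3) (Fin 3) F) : Module.End F (M3 F) :=
  primitive (ofRows (m.submatrix (Equiv.swap 0 1) (Equiv.swap 0 1)))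

/-- The primitive operator of type `c`: the diagonal action is conjugated with the
transposition of the last two coordinates. -/
def primC (m : Matrix (Fin 3) (Fin 3) F) : Module.End F (M3 F) :=
  primitive (ofRows (m.submatrix (Equiv.swap 1 2) (Equiv.swap 1 2)))

/-- The labels of the 36 operators. -/
inductive Case : Type
  | c1a | c1b | c1c
  | c2a | c2b | c2c
  | c3a | c3b | c3c
  | c4a | c4b | c4c
  | c5a | c5b
  | c6a | c6b | c6c
  | c7a | c7b | c7c
  | c1_I
  | c6_I | c6_II | c6_III
  | c2_I | c2_II
  | c3_I | c3_II
  | c4_I | c4_II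
  | c5_I | c5_II
  | c6_IV | c6_V | c6_VI
  | c8_I

variable (F) in
/-- The 36 operators. In each table the `(i,j)` entry is the image of `e_{ij}`. -/
def listed : Case → Module.End F (M3 F)
  | .c1a => primA rows1
  | .c1b => primB rows1
  | .c1c => primC rows1
  | .c2a => primA rows2
  | .c2b => primB rows2
  | .c2c => primC rows2
  | .c3a => primA rows3
  | .c3b => primB rows3
  | .c3c => primC rows3
  | .c4a => primA rows4
  | .c4b => primB rows4
  | .c4c => primC rows4
  | .c5a => primA rows5
  | .c5b => primB rows5
  | .c6a => primA rows6
  | .c6b => primB rows6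
  | .c6c => primC rows6
  | .c7a => primA rows7
  | .c7b => primB rows7
  | .c7c => primC rows7
  | .c1_I => ofTable
      !![e22 + e33, -e12, -e13;
         -e32, e33, e12 - e23;
         0, 0, 0]
  | .c6_I => ofTable
      !![e22, -e12 - e32, e11 + e22 - e13;
         -e21 + e23, 0, 0;
         -e31 + e33, 0, 0]
  | .c6_II => ofTable
      !![e22, 0, 0;
         -e21, 0, 0;
         -e31 + e11 + e22, 0, 0]
  | .c6_III => ofTable
      !![e22, 0, 0;
         -e21 - e23, 0, 0;
         -e31 + e11 + e22, 0, 0]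
  | .c2_I => ofTable
      !![e22 + e33, -e12, -e13;
         0, e33, -e23;
         0, e33, -e33]
  | .c2_II => ofTable
      !![e22 + e33, -e12, -e13;
         0, e33, e33;
         0, -e32, -e33]
  | .c3_I => ofTable
      !![-e11, -e12, -e13;
         0, -(e11 + e22), -e23;
         0, e11 + e22, e11 + e22]
  | .c3_II => ofTable
      !![-e11, -e12, -e13;
         0, -(e11 + e22), e11 + e22;
         0, -e32, e11 + e22]
  | .c4_I => ofTable
      !![0, -e12, -e13;
         0, e11 + e33, e33;
         0, -e32, -e33]
  | .c4_II => ofTable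
      !![0, -e12, -e13;
         0, e11 + e33, -e23;
         0, e33, -e33]
  | .c5_I => ofTable
      !![e22 + e33, -e12, -e13;
         0, 0, 0;
         0, 0, 0]
  | .c5_II => ofTable
      !![e22 + e33, -e12, -e13;
         0, 0, 0;
         0, e33 - e32, 0]
  | .c6_IV => ofTable
      !![0, -e12, -e13;
         0, e11, -e23 + e11 + e22;
         0, 0, 0]
  | .c6_V => ofTable
      !![0, -e12, -e13;
         0, e11, 0;
         0, -e32 + e11 + e22, 0]
  | .c6_VI => ofTable
      !![e22, -e12, -e13;
         0, 0, 0;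
         0, 0, 0]
  | .c8_I => ofTable
      !![-e11, -e12, -e13;
         0, 0, 0;
         0, e11 + e22 - e32, 0]

end RotaBaxter

/-! Let `P` be an operator on `M_n(k)` and let `P*` be its adjoint for the trace form
`(x, y) ↦ tr (x * y)`. Starting from `⊤` and `1`, build subspaces by taking images under `P`,
`P + 1`, `P*` and `P* + 1`, commutators, and triple products symmetrized under reversal.
Automorphisms and antiautomorphisms preserve the trace, so they carry the subspaces of `P` to those
of a conjugate of `P`; the map `φ` exchanges `P` with `P + 1` and `P*` with `P* + 1` up to sign,
which does not affect images. Hence, up to this exchange, it is an invariant of the orbit which of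
the subspaces vanish, and finitely many of them suffice to tell the 36 operators apart.

All operators are defined over `ℤ`, so the subspaces have integer generators. When some coefficient
of a generator is `±1`, the subspace is nonzero over every field, so that a computation over `ℤ`
settles the question for all `F` at once.
-/

namespace RotaBaxter

theorem isRotaBaxter_of_basis {F A ι : Type*} [Field F] [Ring A] [Algebra F A] {lam : F}
    {R : Module.End F A} (b : Module.Basis ι F A)
    (h : ∀ i j, R (b i) * R (b j) = R (R (b i) * b j + b i * R (b j) + lam • (b i * b j))) :
    IsRotaBaxter lam R := by
  let mul := LinearMap.mul F A
  have : mul.compl₁₂ R R =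
      (mul.compl₁₂ R .id + mul.compl₁₂ .id R + lam • mul).compr₂ R :=
    LinearMap.ext_basis b b h
  exact fun x y => LinearMap.congr_fun₂ this x y

section Subspaces

variable {k A L : Type*} [CommRing k] [Ring A] [Algebra k A]

variable (k A) in
/-- The commutator of `A` as a bilinear map. -/
def commutator : A →ₗ[k] A →ₗ[k] A := LinearMap.mul k A - (LinearMap.mul k A).flip

theorem map₂_neg {M N P : Type*} [AddCommGroup M] [AddCommGroup N] [AddCommGroup P] [Module k M]
    [Module k N] [Module k P] (B : M →ₗ[k] N →ₗ[k] P) (p : Submodule k M) (q : Submodule k N) :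
    Submodule.map₂ (-B) p q = Submodule.map₂ B p q := by
  simpa [LinearMap.comp_neg] using (Submodule.map₂_map_left B (-LinearMap.id) p q).symm

/-- Expressions for subspaces of an algebra that are built canonically from a family of operators
with labels in `L`. -/
inductive SubspaceExpr (L : Type*)
  | top
  | one
  | op (l : L) (e : SubspaceExpr L)
  | lie (e₁ e₂ : SubspaceExpr L)
  | triple (e₁ e₂ e₃ : SubspaceExpr L)

namespace SubspaceExpr

/-- The subspace denoted by an expression. A triple is made symmetric under the reversal of
products, so that antiautomorphisms respect it. -/
def denote (f : L → Module.End k A) : SubspaceExpr L → Submodule k A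
  | top => ⊤
  | one => 1
  | op l e => (e.denote f).map (f l)
  | lie e₁ e₂ => Submodule.map₂ (commutator k A) (e₁.denote f) (e₂.denote f)
  | triple e₁ e₂ e₃ =>
      e₁.denote f * e₂.denote f * e₃.denote f ⊔ e₃.denote f * e₂.denote f * e₁.denote f

/-- Rename the operators of an expression. -/
def relabel (σ : L → L) : SubspaceExpr L → SubspaceExpr L
  | top => top
  | one => one
  | op l e => op (σ l) (e.relabel σ)
  | lie e₁ e₂ => lie (e₁.relabel σ) (e₂.relabel σ)
  | triple e₁ e₂ e₃ => triple (e₁.relabel σ) (e₂.relabel σ) (e₃.relabel σ)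

theorem relabel_involutive {σ : L → L} (hσ : Function.Involutive σ) :
    Function.Involutive (relabel σ) := fun e => by
  induction e <;> simp_all [relabel, hσ _]

theorem denote_relabel (f : L → Module.End k A) (σ : L → L) (e : SubspaceExpr L) :
    (e.relabel σ).denote f = e.denote (f ∘ σ) := by
  induction e <;> simp_all [relabel, denote]

theorem denote_neg (f : L → Module.End k A) (e : SubspaceExpr L) :
    e.denote (-f) = e.denote f := by
  induction e <;> simp_all [denote, Submodule.map_neg]

end SubspaceExpr

/-- A linear bijection of an algebra that is an automorphism or an antiautomorphism. -/
def IsAutOrAntiAut (α : A ≃ₗ[k] A) : Prop :=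
  (∀ x y, α (x * y) = α x * α y) ∨ ∀ x y, α (x * y) = α y * α x

namespace IsAutOrAntiAut

variable {α : A ≃ₗ[k] A}

theorem map_one (hα : IsAutOrAntiAut α) : α 1 = 1 := by
  obtain ⟨x, hx⟩ := α.surjective 1
  rcases hα with hα | hα
  · simpa [hx] using (hα x 1).symm
  · simpa [hx] using (hα 1 x).symm

theorem map_submodule_one (hα : IsAutOrAntiAut α) :
    (1 : Submodule k A).map α.toLinearMap = 1 := by
  simp [Submodule.one_eq_span, Submodule.map_span, hα.map_one]

theorem map_submodule_mul (hα : IsAutOrAntiAut α) :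
    (∀ p q : Submodule k A,
      (p * q).map α.toLinearMap = p.map α.toLinearMap * q.map α.toLinearMap) ∨
    ∀ p q : Submodule k A,
      (p * q).map α.toLinearMap = q.map α.toLinearMap * p.map α.toLinearMap := by
  refine hα.imp (fun hα p q => ?_) fun hα p q => ?_
  · have : (LinearMap.mul k A).compr₂ α.toLinearMap =
        (LinearMap.mul k A).compl₁₂ α.toLinearMap α.toLinearMap := by
      ext x y
      exact hα x y
    rw [Submodule.mul_eq_map₂, Submodule.mul_eq_map₂, Submodule.map_map₂, this,
      Submodule.map₂_map_map]
  · have : (LinearMap.mul k A).compr₂ α.toLinearMap =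
        (LinearMap.mul k A).flip.compl₁₂ α.toLinearMap α.toLinearMap := by
      ext x y
      exact hα x y
    rw [Submodule.mul_eq_map₂, Submodule.mul_eq_map₂, Submodule.map_map₂, this,
      ← Submodule.map₂_map_map, Submodule.map₂_flip]

theorem map_submodule_commutator (hα : IsAutOrAntiAut α) (p q : Submodule k A) :
    (Submodule.map₂ (commutator k A) p q).map α.toLinearMap =
      Submodule.map₂ (commutator k A) (p.map α.toLinearMap) (q.map α.toLinearMap) := by
  rw [Submodule.map_map₂, Submodule.map₂_map_map]
  rcases hα with hα | hα
  · congr 1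
    ext x y
    simp [commutator, hα]
  · rw [← map₂_neg]
    congr 1
    ext x y
    simp [commutator, hα]

theorem map_denote (hα : IsAutOrAntiAut α) {f g : L → Module.End k A}
    (h : ∀ l x, α (f l x) = g l (α x)) (e : SubspaceExpr L) :
    (e.denote f).map α.toLinearMap = e.denote g := by
  induction e with
  | top => exact Submodule.map_top _ |>.trans α.range
  | one => exact hα.map_submodule_one
  | op l e ih =>
    have : α.toLinearMap ∘ₗ f l = g l ∘ₗ α := LinearMap.ext (h l)
    rw [SubspaceExpr.denote, SubspaceExpr.denote, ← ih, ← Submodule.map_comp, this,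
      Submodule.map_comp]
  | lie e₁ e₂ ih₁ ih₂ =>
    rw [SubspaceExpr.denote, SubspaceExpr.denote, hα.map_submodule_commutator, ih₁, ih₂]
  | triple e₁ e₂ e₃ ih₁ ih₂ ih₃ =>
    rcases hα.map_submodule_mul with hm | hm
    · simp only [SubspaceExpr.denote, Submodule.map_sup, hm, ih₁, ih₂, ih₃]
    · simp only [SubspaceExpr.denote, Submodule.map_sup, hm, ih₁, ih₂, ih₃, ← mul_assoc]
      exact sup_comm _ _

theorem denote_eq_bot_iff (hα : IsAutOrAntiAut α) {f g : L → Module.End k A}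
    (h : ∀ l x, α (f l x) = g l (α x)) (e : SubspaceExpr L) :
    e.denote f = ⊥ ↔ e.denote g = ⊥ := by
  rw [← hα.map_denote h e]
  exact Submodule.map_eq_bot_iff.symm

end IsAutOrAntiAut

end Subspaces

section Adjoint

variable {k n : Type*} [Fintype n] [DecidableEq n]

theorem trace_apply_of_isAutOrAntiAut [Field k] {α : Matrix n n k ≃ₗ[k] Matrix n n k}
    (hα : IsAutOrAntiAut α) (x : Matrix n n k) : (α x).trace = x.trace := by
  rcases id hα with hm | hm
  · exact Matrix.trace_map (AlgEquiv.ofLinearEquiv α hα.map_one hm) x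
  · let β := α.trans (Matrix.transposeLinearEquiv n n k k)
    have hβ : ∀ x y, β (x * y) = β x * β y := fun x y => by simp [β, hm]
    rw [← Matrix.trace_transpose]
    exact Matrix.trace_map (AlgEquiv.ofLinearEquiv β (by simp [β, hα.map_one]) hβ) x

variable [CommRing k]

/-- The adjoint of an operator on matrices for the trace form `(x, y) ↦ tr (x * y)`, as a linear
function of the operator. -/
def traceAdjoint : Module.End k (Matrix n n k) →ₗ[k] Module.End k (Matrix n n k) :=
  LinearMap.mk₂ k (fun P x => Matrix.of fun i j => (x * P (Matrix.single j i 1)).trace)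
    (fun _ _ _ => by ext; simp [mul_add]) (fun _ _ _ => by ext; simp)
    (fun _ _ _ => by ext; simp [add_mul]) (fun _ _ _ => by ext; simp)

theorem trace_traceAdjoint_mul (P : Module.End k (Matrix n n k)) (x y : Matrix n n k) :
    (traceAdjoint P x * y).trace = (x * P y).trace := by
  have : Matrix.traceLinearMap n k k ∘ₗ LinearMap.mulLeft k (traceAdjoint P x) =
      Matrix.traceLinearMap n k k ∘ₗ LinearMap.mulLeft k x ∘ₗ P :=
    Matrix.ext_linearMap k fun i j => LinearMap.ext_ring <| by
      simp [Matrix.trace_mul_single, traceAdjoint]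
  exact LinearMap.congr_fun this y

theorem eq_traceAdjoint_iff {P Q : Module.End k (Matrix n n k)} :
    Q = traceAdjoint P ↔ ∀ x y, (Q x * y).trace = (x * P y).trace := by
  refine ⟨fun h => h ▸ trace_traceAdjoint_mul P, fun h => LinearMap.ext fun x => ?_⟩
  exact Matrix.ext_iff_trace_mul_right.mpr fun y => by rw [h, trace_traceAdjoint_mul]

theorem traceAdjoint_one : traceAdjoint (1 : Module.End k (Matrix n n k)) = 1 :=
  (eq_traceAdjoint_iff.mpr fun _ _ => rfl).symm

end Adjoint

theorem traceAdjoint_intertwines {k n : Type*} [Field k] [Fintype n] [DecidableEq n]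
    {α : Matrix n n k ≃ₗ[k] Matrix n n k} (hα : IsAutOrAntiAut α)
    {P Q : Module.End k (Matrix n n k)} (h : ∀ x, α (P x) = Q (α x)) (x : Matrix n n k) :
    α (traceAdjoint P x) = traceAdjoint Q (α x) := by
  have trace_mul (y z : Matrix n n k) : (α y * α z).trace = (y * z).trace := by
    rw [← trace_apply_of_isAutOrAntiAut hα (y * z)]
    rcases hα with hα | hα
    · rw [hα]
    · rw [hα, Matrix.trace_mul_comm]
  refine Matrix.ext_iff_trace_mul_right.mpr (α.surjective.forall.mpr fun y => ?_)
  rw [trace_mul, trace_traceAdjoint_mul, trace_traceAdjoint_mul, ← h, trace_mul]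

/-- The operators attached to an operator `P` on matrices: `P`, `P + 1`, and the adjoints of these
for the trace form. -/
inductive Letter
  | op | opSucc | adj | adjSucc

namespace Letter

/-- The exchange of letters that corresponds to `φ`. -/
def swap : Letter → Letter
  | op => opSucc
  | opSucc => op
  | adj => adjSucc
  | adjSucc => adj

theorem swap_involutive : Function.Involutive swap := by
  rintro (_ | _ | _ | _) <;> rfl

variable {k n : Type*} [CommRing k] [Fintype n] [DecidableEq n]

/-- The operator denoted by a letter. -/
def denote (P : Module.End k (Matrix n n k)) : Letter → Module.End k (Matrix n n k)
  | op => P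
  | opSucc => P + 1
  | adj => traceAdjoint P
  | adjSucc => traceAdjoint P + 1

end Letter

section Orbits

variable {k n : Type*} [Field k] [Fintype n] [DecidableEq n]

theorem denote_phi (P : Module.End k (Matrix n n k)) :
    Letter.denote (phi 1 P) = -(Letter.denote P ∘ Letter.swap) := by
  have h : phi 1 P = -P - 1 := by rw [phi, one_smul]; rfl
  funext l
  cases l <;> simp [Letter.denote, Letter.swap, h, traceAdjoint_one, sub_eq_add_neg, add_comm]

/-- The subspace that the expression `e` attaches to the operator `P` is zero. -/
def Vanishes (P : Module.End k (Matrix n n k)) (e : SubspaceExpr Letter) : Prop :=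
  e.denote (Letter.denote P) = ⊥

theorem vanishes_phi_iff (P : Module.End k (Matrix n n k)) (e : SubspaceExpr Letter) :
    Vanishes (phi 1 P) e ↔ Vanishes P (e.relabel Letter.swap) := by
  rw [Vanishes, Vanishes, denote_phi, SubspaceExpr.denote_neg, SubspaceExpr.denote_relabel]

theorem IsAutOrAntiAut.vanishes_iff {α : Matrix n n k ≃ₗ[k] Matrix n n k} (hα : IsAutOrAntiAut α)
    {P Q : Module.End k (Matrix n n k)} (h : ∀ x, α (P x) = Q (α x)) (e : SubspaceExpr Letter) :
    Vanishes P e ↔ Vanishes Q e := by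
  refine hα.denote_eq_bot_iff (fun l x => ?_) e
  cases l <;> simp [Letter.denote, h, traceAdjoint_intertwines hα h]

theorem vanishes_of_mem_symmetryGroup {F : Type*} [Field F] {g : Equiv.Perm (Module.End F (M3 F))}
    (hg : g ∈ symmetryGroup F) (P : Module.End F (M3 F)) :
    (∀ e, Vanishes (g P) e ↔ Vanishes P e) ∨
      ∀ e, Vanishes (g P) e ↔ Vanishes P (e.relabel Letter.swap) := by
  induction hg using Subgroup.closure_induction generalizing P with
  | mem g hg =>
    rcases hg with (rfl | rfl) | ⟨ψ, rfl⟩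
    · exact .inr (vanishes_phi_iff P)
    · have hT : IsAutOrAntiAut (Matrix.transposeLinearEquiv (Fin 3) (Fin 3) F F) :=
        .inr Matrix.transpose_mul
      exact .inl (hT.vanishes_iff fun _ => rfl)
    · have hψ : IsAutOrAntiAut ψ.toLinearEquiv := .inl (map_mul ψ)
      exact .inl (hψ.vanishes_iff fun _ => ψ.apply_symm_apply _)
  | one => exact .inl fun _ => .rfl
  | mul g h _ _ hg hh =>
    have inv := SubspaceExpr.relabel_involutive Letter.swap_involutive
    rcases hg (h P) with hg | hg <;> rcases hh P with hh | hh
    · exact .inl fun e => (hg e).trans (hh e)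
    · exact .inr fun e => (hg e).trans (hh e)
    · exact .inr fun e => (hg e).trans (hh _)
    · exact .inl fun e => (hg e).trans ((hh _).trans (by rw [inv e]))
  | inv g _ hg =>
    have inv := SubspaceExpr.relabel_involutive Letter.swap_involutive
    have apply_inv : g (g⁻¹ P) = P := g.apply_symm_apply P
    refine (hg (g⁻¹ P)).imp (fun h e => ?_) fun h e => ?_
    · rw [← h e, apply_inv]
    · rw [← inv e, ← h, apply_inv, inv e]

theorem vanishes_of_orbit_eq {F : Type*} [Field F] {P Q : Module.End F (M3 F)}
    (h : orbit P = orbit Q) : (∀ e, Vanishes Q e ↔ Vanishes P e) ∨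
      ∀ e, Vanishes Q e ↔ Vanishes P (e.relabel Letter.swap) := by
  obtain ⟨g, rfl⟩ : Q ∈ orbit P := h ▸ MulAction.mem_orbit_self Q
  exact vanishes_of_mem_symmetryGroup g.2 P

end Orbits

/-- Integer combinations of the elements of `ι`, as lists of elements with coefficients. They
allow exact computations, valid over every field, by evaluation in the kernel. -/
abbrev Sparse (ι : Type*) : Type _ := List (ι × ℤ)

namespace Sparse

variable {ι κ ι' M N P : Type*}

section Eval

variable [AddCommGroup M] [AddCommGroup N]

/-- The value of a combination when each index `i` stands for `v i`. -/
def eval (v : ι → M) (u : Sparse ι) : M := (u.map fun t => t.2 • v t.1).sum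

@[simp] theorem eval_nil (v : ι → M) : eval v [] = 0 := rfl

@[simp] theorem eval_cons (v : ι → M) (t : ι × ℤ) (u : Sparse ι) :
    eval v (t :: u) = t.2 • v t.1 + eval v u := by
  simp [eval]

theorem eval_append (v : ι → M) (u w : Sparse ι) : eval v (u ++ w) = eval v u + eval v w := by
  simp [eval]

theorem eval_flatMap (v : ι → M) (f : κ → Sparse ι) (l : List κ) :
    eval v (l.flatMap f) = (l.map fun i => eval v (f i)).sum := by
  induction l with
  | nil => rfl
  | cons i l ih => rw [List.flatMap_cons, eval_append, ih, List.map_cons, List.sum_cons]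

theorem map_eval (φ : M →+ N) (v : ι → M) (u : Sparse ι) :
    φ (eval v u) = eval (fun i => φ (v i)) u := by
  induction u <;> simp_all

/-- The negative of a combination. -/
def neg (u : Sparse ι) : Sparse ι := u.map fun t => (t.1, -t.2)

theorem eval_neg (v : ι → M) (u : Sparse ι) : eval v (neg u) = -eval v u := by
  induction u <;> simp_all [neg, add_comm]

/-- Replace the indices by their images under `f`. -/
def reindex (f : ι → κ) (u : Sparse ι) : Sparse κ := u.map fun t => (f t.1, t.2)

theorem eval_reindex (f : ι → κ) (v : κ → M) (u : Sparse ι) :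
    eval v (reindex f u) = eval (v ∘ f) u := by
  induction u <;> simp_all [reindex]

/-- Add the term `t` to a combination, merging it with the term of the same index. -/
def addTerm [DecidableEq ι] (t : ι × ℤ) : Sparse ι → Sparse ι
  | [] => [t]
  | s :: u =>
    if s.1 = t.1 then if s.2 + t.2 = 0 then u else (s.1, s.2 + t.2) :: u else s :: addTerm t u

/-- Merge the terms with the same index. -/
def collect [DecidableEq ι] (u : Sparse ι) : Sparse ι := u.foldr addTerm []

variable [DecidableEq ι]

theorem eval_addTerm (v : ι → M) (t : ι × ℤ) (u : Sparse ι) :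
    eval v (addTerm t u) = t.2 • v t.1 + eval v u := by
  induction u with
  | nil => simp [addTerm]
  | cons s u ih =>
    rw [addTerm]
    split_ifs with h h₀
    · have : t.2 • v t.1 + s.2 • v s.1 = 0 := by rw [h, ← add_smul, add_comm, h₀, zero_smul]
      rw [eval_cons, ← add_assoc, this, zero_add]
    · rw [eval_cons, eval_cons, h, add_smul]
      abel
    · rw [eval_cons, eval_cons, ih]
      abel

theorem eval_collect (v : ι → M) (u : Sparse ι) : eval v (collect u) = eval v u := by
  induction u with
  | nil => rfl
  | cons t u ih => rw [collect, List.foldr_cons, eval_addTerm, eval_cons, ← collect, ih]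

/-- The difference of two combinations. -/
def sub (u w : Sparse ι) : Sparse ι := collect (u ++ neg w)

theorem eval_sub (v : ι → M) (u w : Sparse ι) : eval v (sub u w) = eval v u - eval v w := by
  rw [sub, eval_collect, eval_append, eval_neg, sub_eq_add_neg]

end Eval

/-- The bilinear extension of a partial function on indices, with value zero where the function is
undefined. -/
def bilin [DecidableEq ι'] (f : ι → κ → Option ι') (u : Sparse ι) (w : Sparse κ) : Sparse ι' :=
  collect (u.flatMap fun s => w.filterMap fun t => (f s.1 t.1).map (·, s.2 * t.2))

theorem eval_bilin {k : Type*} [CommRing k] [AddCommGroup M] [AddCommGroup N] [AddCommGroup P]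
    [Module k M] [Module k N] [Module k P] [DecidableEq ι'] {f : ι → κ → Option ι'}
    {v : ι → M} {w : κ → N} {x : ι' → P} {B : M →ₗ[k] N →ₗ[k] P}
    (h : ∀ i j, (f i j).elim 0 x = B (v i) (w j)) (u : Sparse ι) (u' : Sparse κ) :
    eval x (bilin f u u') = B (eval v u) (eval w u') := by
  have eval_row (s : ι × ℤ) : eval x (u'.filterMap fun t => (f s.1 t.1).map (·, s.2 * t.2)) =
      s.2 • B (v s.1) (eval w u') := by
    induction u' with
    | nil => simp
    | cons t u' ih =>
      have term : (f s.1 t.1).elim 0 (fun i => (s.2 * t.2) • x i) =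
          s.2 • t.2 • B (v s.1) (w t.1) := by
        rw [← h, ← mul_smul]
        cases f s.1 t.1 <;> simp
      rw [eval_cons, map_add, smul_add, map_zsmul, ← ih, ← term]
      cases hf : f s.1 t.1 <;> simp [hf]
  rw [bilin, eval_collect]
  induction u with
  | nil => simp
  | cons s u ih =>
    rw [List.flatMap_cons, eval_append, eval_row, ih, eval_cons, map_add, LinearMap.add_apply,
      map_zsmul, LinearMap.smul_apply]

end Sparse

/-- Integer matrices as combinations of matrix units. -/
abbrev SparseMat (n : Type*) : Type _ := Sparse (n × n)

/-- Integer operators on matrices: the index `(s, t)` stands for the operator that sends the matrix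
unit at `s` to the matrix unit at `t` and all other matrix units to zero. -/
abbrev SparseOp (n : Type*) : Type _ := Sparse ((n × n) × n × n)

section Model

variable {n : Type*} [DecidableEq n]

variable (k : Type*) [CommRing k]

/-- The matrix unit at a position. -/
def unitMat (s : n × n) : Matrix n n k := Matrix.single s.1 s.2 1

/-- The operator that sends the matrix unit at `s` to the matrix unit at `t` and all other matrix
units to zero. -/
def unitOp (s : (n × n) × n × n) : Module.End k (Matrix n n k) :=
  (Matrix.entryLinearMap k k s.1.1 s.1.2).smulRight (unitMat k s.2)

variable {k} in
theorem unitOp_apply (s : (n × n) × n × n) (x : Matrix n n k) :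
    unitOp k s x = x s.1.1 s.1.2 • unitMat k s.2 := rfl

namespace SparseMat

/-- The matrix over `k` of a sparse integer matrix. -/
def toMat (u : SparseMat n) : Matrix n n k := u.eval (unitMat k)

/-- The coefficient of a sparse matrix at a position. -/
def coeff (u : SparseMat n) (s : n × n) : ℤ := u.eval fun t => if t = s then 1 else 0

variable {k} in
theorem toMat_apply (u : SparseMat n) (i j : n) : u.toMat k i j = (u.coeff (i, j) : k) := by
  have map_entry := Sparse.map_eval (Matrix.entryLinearMap k k i j).toAddMonoidHom (unitMat k) u
  have map_cast := Sparse.map_eval (Int.castAddHom k) (fun t => if t = (i, j) then 1 else 0) u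
  refine map_entry.trans (Eq.trans ?_ map_cast.symm)
  congr 1
  ext t
  by_cases h : t = (i, j) <;> simp_all [unitMat, Matrix.single_apply, Prod.ext_iff]

@[simp] theorem toMat_nil : toMat k ([] : SparseMat n) = 0 := rfl

theorem toMat_append (u v : SparseMat n) : toMat k (u ++ v) = u.toMat k + v.toMat k :=
  Sparse.eval_append _ u v

theorem toMat_neg (u : SparseMat n) : toMat k u.neg = -u.toMat k :=
  Sparse.eval_neg _ u

/-- The matrix unit at a position, as a sparse matrix. -/
def unit (i j : n) : SparseMat n := [((i, j), 1)]

theorem toMat_unit (i j : n) : (unit i j).toMat k = Matrix.single i j 1 := by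
  simp [unit, toMat, unitMat]

/-- The product of sparse matrices. -/
def mul (u v : SparseMat n) : SparseMat n :=
  Sparse.bilin (fun s t => if s.2 = t.1 then some (s.1, t.2) else none) u v

/-- The commutator of sparse matrices. -/
def lie (u v : SparseMat n) : SparseMat n := (u.mul v).sub (v.mul u)

variable [Fintype n]

theorem toMat_mul (u v : SparseMat n) : (u.mul v).toMat k = u.toMat k * v.toMat k := by
  refine Sparse.eval_bilin (B := LinearMap.mul k (Matrix n n k)) (fun s t => ?_) u v
  by_cases h : s.2 = t.1 <;> simp [unitMat, h]

theorem toMat_lie (u v : SparseMat n) :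
    (u.lie v).toMat k = commutator k _ (u.toMat k) (v.toMat k) := by
  rw [lie, toMat, Sparse.eval_sub, ← toMat, ← toMat, toMat_mul, toMat_mul]
  rfl

end SparseMat

namespace SparseOp

/-- The operator over `k` of a sparse integer operator. -/
def toEnd (p : SparseOp n) : Module.End k (Matrix n n k) := p.eval (unitOp k)

variable {k} in
theorem toEnd_apply (p : SparseOp n) (x : Matrix n n k) :
    p.toEnd k x = p.eval fun s => unitOp k s x := by
  induction p <;> simp_all [toEnd]

/-- Apply a sparse operator to a sparse matrix. -/
def apply (p : SparseOp n) (u : SparseMat n) : SparseMat n :=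
  Sparse.bilin (fun s t => if s.1 = t then some s.2 else none) p u

theorem toMat_apply (p : SparseOp n) (u : SparseMat n) :
    (p.apply u).toMat k = p.toEnd k (u.toMat k) := by
  refine Sparse.eval_bilin (B := LinearMap.id) (fun s t => ?_) p u
  by_cases h : s.1 = t
  · simp [unitOp_apply, unitMat, h]
  · have : unitMat k t s.1.1 s.1.2 = 0 := Matrix.single_apply_of_ne _ _ _ _ _ fun ht =>
      h (Prod.ext ht.1.symm ht.2.symm)
    simp [unitOp_apply, this, h]

/-- The adjoint of a sparse operator for the trace form. -/
def adjoint (p : SparseOp n) : SparseOp n := p.reindex fun s => (s.2.swap, s.1.swap)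

theorem toEnd_adjoint [Fintype n] (p : SparseOp n) :
    p.adjoint.toEnd k = traceAdjoint (p.toEnd k) := by
  rw [adjoint, toEnd, Sparse.eval_reindex]
  refine Eq.trans ?_ (Sparse.map_eval (traceAdjoint (k := k)).toAddMonoidHom (unitOp k) p).symm
  congr 1
  ext1 s
  refine eq_traceAdjoint_iff.mpr fun x y => ?_
  simp [unitOp_apply, unitMat, Matrix.trace_single_mul, Matrix.trace_mul_single]

end SparseOp

end Model

section FinModel

variable {m : ℕ}

/-- The positions of an `m × m` matrix. -/
def positions (m : ℕ) : List (Fin m × Fin m) := List.finRange m ×ˢ List.finRange m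

theorem mem_positions (s : Fin m × Fin m) : s ∈ positions m :=
  List.pair_mem_product.mpr ⟨List.mem_finRange _, List.mem_finRange _⟩

theorem sum_map_positions {M : Type*} [AddCommMonoid M] (f : Fin m × Fin m → M) :
    ((positions m).map f).sum = ∑ s, f s := by
  have nodup : (positions m).Nodup := (List.nodup_finRange m).product (List.nodup_finRange m)
  rw [← List.sum_toFinset f nodup]
  congr 1
  ext s
  simp [mem_positions]

variable (k : Type*) [CommRing k]

/-- The identity matrix. -/
def SparseMat.one (m : ℕ) : SparseMat (Fin m) := (List.finRange m).map fun i => ((i, i), 1)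

theorem SparseMat.toMat_one : (SparseMat.one m).toMat k = 1 := by
  have : (SparseMat.one m).toMat k = ∑ i, unitMat k (i, i) := by
    simp [one, toMat, Sparse.eval, Function.comp_def, Fin.sum_univ_def]
  rw [this]
  ext i j
  simp [unitMat, Matrix.sum_apply, Matrix.single_apply, Matrix.one_apply, ite_and]

namespace SparseOp

/-- The sum of a sparse operator and the identity. -/
def succ (p : SparseOp (Fin m)) : SparseOp (Fin m) :=
  p ++ (positions m).map fun s => ((s, s), 1)

theorem toEnd_succ (p : SparseOp (Fin m)) : p.succ.toEnd k = p.toEnd k + 1 := by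
  have sum_unitOp : ∑ s : Fin m × Fin m, unitOp k (s, s) = 1 := by
    refine LinearMap.ext fun x => ?_
    rw [LinearMap.sum_apply, Fintype.sum_prod_type, Module.End.one_apply]
    conv_rhs => rw [Matrix.matrix_eq_sum_single x]
    simp [unitOp_apply, unitMat]
  rw [succ, toEnd, Sparse.eval_append, ← toEnd, ← sum_unitOp, ← sum_map_positions]
  simp [Sparse.eval, Function.comp_def]

/-- The sparse operator denoted by a letter. -/
def letter (p : SparseOp (Fin m)) : Letter → SparseOp (Fin m)
  | .op => p
  | .opSucc => p.succ
  | .adj => p.adjoint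
  | .adjSucc => p.adjoint.succ

theorem toEnd_letter (p : SparseOp (Fin m)) (l : Letter) :
    (p.letter l).toEnd k = l.denote (p.toEnd k) := by
  cases l <;> simp [letter, Letter.denote, toEnd_succ, toEnd_adjoint]

/-- Whether the Rota-Baxter identity of weight one holds on matrix units. -/
def isRotaBaxter (p : SparseOp (Fin m)) : Bool :=
  (positions m).all fun s => (positions m).all fun t =>
    let x := SparseMat.unit s.1 s.2
    let y := SparseMat.unit t.1 t.2
    let px := p.apply x
    let py := p.apply y
    (px.mul py).sub (p.apply (px.mul y ++ x.mul py ++ x.mul y)) = []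

theorem isRotaBaxter_toEnd {F : Type*} [Field F] {p : SparseOp (Fin m)} (h : p.isRotaBaxter) :
    IsRotaBaxter (1 : F) (p.toEnd F) := by
  refine isRotaBaxter_of_basis (Matrix.stdBasis F (Fin m) (Fin m)) fun ⟨i, j⟩ ⟨i', j'⟩ => ?_
  simp only [isRotaBaxter, List.all_eq_true, decide_eq_true_eq] at h
  have := congrArg (SparseMat.toMat F) (h (i, j) (mem_positions _) (i', j') (mem_positions _))
  rw [SparseMat.toMat, Sparse.eval_sub] at this
  simpa only [← SparseMat.toMat.eq_def, toMat_apply, SparseMat.toMat_mul, SparseMat.toMat_append,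
    SparseMat.toMat_unit, ← Matrix.stdBasis_eq_single, one_smul] using sub_eq_zero.mp this

end SparseOp
end FinModel

section Spans

variable {n : Type*} (k : Type*) [DecidableEq n] [CommRing k]

/-- The span of a list of sparse matrices. -/
def spanOf (l : List (SparseMat n)) : Submodule k (Matrix n n k) :=
  Submodule.span k {x | ∃ u ∈ l, u.toMat k = x}

/-- Remove zeros and repetitions from a list of sparse matrices. -/
def clean (l : List (SparseMat n)) : List (SparseMat n) := (l.filter (· ≠ [])).dedup

theorem spanOf_clean (l : List (SparseMat n)) : spanOf k (clean l) = spanOf k l := by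
  refine le_antisymm (Submodule.span_mono ?_) (Submodule.span_le.mpr ?_)
  · rintro _ ⟨u, hu, rfl⟩
    exact ⟨u, List.mem_of_mem_filter (List.mem_dedup.mp hu), rfl⟩
  · rintro _ ⟨u, hu, rfl⟩
    by_cases h : u = []
    · rw [h]
      exact zero_mem _
    · exact Submodule.subset_span ⟨u, by simp [clean, hu, h], rfl⟩

theorem spanOf_append (l l' : List (SparseMat n)) :
    spanOf k (l ++ l') = spanOf k l ⊔ spanOf k l' := by
  rw [spanOf, spanOf, spanOf, ← Submodule.span_union]
  congr 1
  ext x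
  simp [or_and_right, exists_or]

variable {k}

theorem spanOf_map {g : SparseMat n → SparseMat n} {φ : Module.End k (Matrix n n k)}
    (h : ∀ u, (g u).toMat k = φ (u.toMat k)) (l : List (SparseMat n)) :
    spanOf k (l.map g) = (spanOf k l).map φ := by
  rw [spanOf, spanOf, Submodule.map_span]
  congr 1
  ext x
  simp [h]

/-- The nonzero values of `g` on the pairs of elements of two lists. -/
def products (g : SparseMat n → SparseMat n → SparseMat n) (l l' : List (SparseMat n)) :
    List (SparseMat n) :=
  clean ((l ×ˢ l').map fun t => g t.1 t.2)

theorem spanOf_products {g : SparseMat n → SparseMat n → SparseMat n}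
    {B : Matrix n n k →ₗ[k] Matrix n n k →ₗ[k] Matrix n n k}
    (h : ∀ u v, (g u v).toMat k = B (u.toMat k) (v.toMat k)) (l l' : List (SparseMat n)) :
    spanOf k (products g l l') = Submodule.map₂ B (spanOf k l) (spanOf k l') := by
  rw [products, spanOf_clean, spanOf, spanOf, spanOf, Submodule.map₂_span_span]
  congr 1
  ext x
  constructor
  · rintro ⟨_, hw, rfl⟩
    obtain ⟨⟨u, v⟩, huv, rfl⟩ := List.mem_map.mp hw
    obtain ⟨hu, hv⟩ := List.pair_mem_product.mp huv
    exact ⟨_, ⟨u, hu, rfl⟩, _, ⟨v, hv, rfl⟩, (h u v).symm⟩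
  · rintro ⟨_, ⟨u, hu, rfl⟩, _, ⟨v, hv, rfl⟩, rfl⟩
    exact ⟨_, List.mem_map.mpr ⟨(u, v), List.pair_mem_product.mpr ⟨hu, hv⟩, rfl⟩, h u v⟩

/-- Some matrix in the list has a coefficient `1` or `-1`, hence is nonzero over every field. -/
abbrev HasUnitCoeff (l : List (SparseMat n)) : Prop :=
  ∃ u ∈ l, ∃ t ∈ u, (u.coeff t.1).natAbs = 1

theorem spanOf_nil : spanOf k ([] : List (SparseMat n)) = ⊥ := by
  simp [spanOf]

theorem HasUnitCoeff.spanOf_ne_bot [Nontrivial k] {l : List (SparseMat n)} (h : HasUnitCoeff l) :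
    spanOf k l ≠ ⊥ := by
  obtain ⟨u, hu, t, -, ht⟩ := h
  intro hl
  have unit : IsUnit ((u.coeff t.1 : ℤ) : k) :=
    (Int.isUnit_iff_natAbs_eq.mpr ht).map (Int.castRingHom k)
  have u_zero : u.toMat k = 0 := Submodule.span_eq_bot.mp hl _ ⟨u, hu, rfl⟩
  exact unit.ne_zero (by rw [← SparseMat.toMat_apply, u_zero, Matrix.zero_apply])

/-- One of two lists of sparse matrices is empty and the other one spans a nonzero space over every
field, by the criterion `HasUnitCoeff`. -/
abbrev ExactlyOneVanishes (l l' : List (SparseMat n)) : Prop :=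
  l = [] ∧ HasUnitCoeff l' ∨ HasUnitCoeff l ∧ l' = []

theorem ExactlyOneVanishes.not_spanOf_eq_bot_iff [Nontrivial k] {l l' : List (SparseMat n)}
    (h : ExactlyOneVanishes l l') : ¬(spanOf k l = ⊥ ↔ spanOf k l' = ⊥) := by
  rcases h with ⟨rfl, h⟩ | ⟨h, rfl⟩ <;> simp [spanOf_nil, h.spanOf_ne_bot]

end Spans

section Generators

variable {m : ℕ} {L : Type*}

/-- Generators of the subspace denoted by an expression. -/
def SubspaceExpr.gens (f : L → SparseOp (Fin m)) : SubspaceExpr L → List (SparseMat (Fin m))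
  | top => (positions m).map fun s => .unit s.1 s.2
  | one => [.one m]
  | op l e => clean ((e.gens f).map (f l).apply)
  | lie e₁ e₂ => products .lie (e₁.gens f) (e₂.gens f)
  | triple e₁ e₂ e₃ =>
      products .mul (products .mul (e₁.gens f) (e₂.gens f)) (e₃.gens f) ++
        products .mul (products .mul (e₃.gens f) (e₂.gens f)) (e₁.gens f)

variable {k : Type*} [CommRing k]

theorem spanOf_mul (l l' : List (SparseMat (Fin m))) :
    spanOf k (products .mul l l') = spanOf k l * spanOf k l' := by
  rw [Submodule.mul_eq_map₂]
  exact spanOf_products (B := LinearMap.mul k (Matrix (Fin m) (Fin m) k))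
    (SparseMat.toMat_mul k) l l'

theorem spanOf_gens {f : L → SparseOp (Fin m)} {g : L → Module.End k (Matrix (Fin m) (Fin m) k)}
    (h : ∀ l, (f l).toEnd k = g l) (e : SubspaceExpr L) :
    spanOf k (e.gens f) = e.denote g := by
  induction e with
  | top =>
    refine eq_top_iff.mpr ((Matrix.stdBasis k _ _).span_eq.ge.trans (Submodule.span_le.mpr ?_))
    rintro _ ⟨⟨i, j⟩, rfl⟩
    refine Submodule.subset_span ⟨_, List.mem_map.mpr ⟨(i, j), mem_positions _, rfl⟩, ?_⟩
    rw [SparseMat.toMat_unit, Matrix.stdBasis_eq_single]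
  | one =>
    simp [spanOf, SubspaceExpr.gens, SubspaceExpr.denote, SparseMat.toMat_one,
      Submodule.one_eq_span]
  | op l e ih =>
    rw [SubspaceExpr.gens, spanOf_clean, spanOf_map (SparseOp.toMat_apply k (f l)), ih, h]
    rfl
  | lie e₁ e₂ ih₁ ih₂ =>
    rw [SubspaceExpr.gens, spanOf_products (SparseMat.toMat_lie k), ih₁, ih₂]
    rfl
  | triple e₁ e₂ e₃ ih₁ ih₂ ih₃ =>
    rw [SubspaceExpr.gens, spanOf_append, spanOf_mul, spanOf_mul, spanOf_mul, spanOf_mul, ih₁, ih₂,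
      ih₃]
    rfl

end Generators

section ListedModel

open scoped Matrix

variable (F : Type*) [Field F]

/-- The sparse form of `ofTable`. -/
def SparseOp.ofTable (t : Matrix (Fin 3) (Fin 3) (SparseMat (Fin 3))) : SparseOp (Fin 3) :=
  (positions 3).flatMap fun s => (t s.1 s.2).reindex fun u => (s, u)

theorem SparseOp.toEnd_ofTable (t : Matrix (Fin 3) (Fin 3) (SparseMat (Fin 3))) :
    (ofTable t).toEnd F = RotaBaxter.ofTable (t.map (SparseMat.toMat F)) := by
  refine LinearMap.ext fun x => ?_
  have image (s : Fin 3 × Fin 3) :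
      ((t s.1 s.2).reindex fun u => (s, u)).eval (fun p => unitOp F p x) =
        x s.1 s.2 • (t s.1 s.2).toMat F := by
    rw [Sparse.eval_reindex]
    exact (Sparse.map_eval (DistribSMul.toAddMonoidHom _ (x s.1 s.2)) _ _).symm
  calc (ofTable t).toEnd F x
    _ = (ofTable t).eval (fun p => unitOp F p x) :=
      toEnd_apply _ x
    _ = ∑ s : Fin 3 × Fin 3, x s.1 s.2 • (t s.1 s.2).toMat F := by
      rw [ofTable, Sparse.eval_flatMap, sum_map_positions]
      simp only [image]
    _ = RotaBaxter.ofTable (t.map (SparseMat.toMat F)) x :=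
      Fintype.sum_prod_type _

/-- The sparse form of `primitive (ofRows m)`. -/
def SparseOp.primitive (r : SparseMat (Fin 3)) : SparseOp (Fin 3) :=
  (r.reindex fun s => ((s.1, s.1), (s.2, s.2))) ++
    ((positions 3).filter fun s => s.2 < s.1).map fun s => ((s, s), -1)

theorem SparseOp.toEnd_primitive (r : SparseMat (Fin 3)) :
    (primitive r).toEnd F = RotaBaxter.primitive (ofRows (r.toMat F)) := by
  refine LinearMap.ext fun x => ?_
  have diagonal_part : ((r.reindex fun s => ((s.1, s.1), (s.2, s.2))).eval fun p => unitOp F p x) =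
      Matrix.diagonal (ofRows (r.toMat F) x.diag) := by
    let φ := Matrix.diagonalLinearMap (Fin 3) F F ∘ₗ Matrix.vecMulBilin F F x.diag
    have map_unit (s : Fin 3 × Fin 3) : unitOp F ((s.1, s.1), (s.2, s.2)) x = φ (unitMat F s) := by
      have vecMul_unit : x.diag ᵥ* Matrix.single s.1 s.2 1 = Pi.single s.2 (x s.1 s.1) := by
        ext j
        simp [Matrix.vecMul, dotProduct, Matrix.single_apply, Pi.single_apply, ite_and,
          eq_comm]
      simp [φ, vecMul_unit, Matrix.diagonal_single, unitOp_apply, unitMat]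
    rw [Sparse.eval_reindex]
    exact (congrArg (Sparse.eval · r) (funext map_unit)).trans
      (Sparse.map_eval φ.toAddMonoidHom (unitMat F) r).symm
  have lower_part : Sparse.eval (fun p => unitOp F p x)
      (((positions 3).filter fun s => s.2 < s.1).map fun s => ((s, s), -1)) =
        -Matrix.of fun i j => if j < i then x i j else 0 := by
    ext i j
    fin_cases i <;> fin_cases j <;>
      simp [positions, unitOp_apply, unitMat, List.finRange]
  rw [toEnd_apply, primitive, Sparse.eval_append, diagonal_part, lower_part, ← sub_eq_add_neg]
  rfl

/-- The sparse form of `fun m => m.submatrix σ σ`. -/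
def SparseMat.permute (σ : Equiv.Perm (Fin 3)) (u : SparseMat (Fin 3)) : SparseMat (Fin 3) :=
  u.reindex (Prod.map σ.symm σ.symm)

theorem SparseMat.toMat_permute (σ : Equiv.Perm (Fin 3)) (u : SparseMat (Fin 3)) :
    (u.permute σ).toMat F = (u.toMat F).submatrix σ σ := by
  rw [permute, toMat, Sparse.eval_reindex]
  refine Eq.trans ?_
    (Sparse.map_eval (Matrix.reindexLinearEquiv F F σ.symm σ.symm).toAddMonoidHom _ _).symm
  congr 1
  ext1 s
  simp [unitMat]

open Sparse SparseMat in
/-- The sparse forms of `rows1`, …, `rows7`. -/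
def sparseRows : Fin 7 → SparseMat (Fin 3)
  | 0 => unit 0 1 ++ unit 0 2 ++ unit 1 2
  | 1 => unit 0 1 ++ unit 0 2 ++ unit 1 2 ++ neg (unit 2 2)
  | 2 => unit 0 1 ++ unit 0 2 ++ neg (unit 1 1 ++ unit 1 2 ++ unit 2 2)
  | 3 => unit 0 1 ++ unit 0 2 ++ neg (unit 1 1)
  | 4 => unit 0 1 ++ unit 0 2
  | 5 => unit 0 1
  | 6 => unit 0 1 ++ neg (unit 2 2)

theorem toMat_sparseRows (i : Fin 7) :
    (sparseRows i).toMat F = ![rows1, rows2, rows3, rows4, rows5, rows6, rows7] i := by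
  ext a b
  rw [SparseMat.toMat_apply]
  fin_cases i <;> fin_cases a <;> fin_cases b <;>
    simp [sparseRows, SparseMat.coeff, SparseMat.unit, Sparse.neg, Sparse.eval,
      rows1, rows2, rows3, rows4, rows5, rows6, rows7]

open Sparse SparseMat in
/-- The sparse forms of the listed operators. -/
def model : Case → SparseOp (Fin 3)
  | .c1a => .primitive (sparseRows 0)
  | .c1b => .primitive ((sparseRows 0).permute (.swap 0 1))
  | .c1c => .primitive ((sparseRows 0).permute (.swap 1 2))
  | .c2a => .primitive (sparseRows 1)
  | .c2b => .primitive ((sparseRows 1).permute (.swap 0 1))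
  | .c2c => .primitive ((sparseRows 1).permute (.swap 1 2))
  | .c3a => .primitive (sparseRows 2)
  | .c3b => .primitive ((sparseRows 2).permute (.swap 0 1))
  | .c3c => .primitive ((sparseRows 2).permute (.swap 1 2))
  | .c4a => .primitive (sparseRows 3)
  | .c4b => .primitive ((sparseRows 3).permute (.swap 0 1))
  | .c4c => .primitive ((sparseRows 3).permute (.swap 1 2))
  | .c5a => .primitive (sparseRows 4)
  | .c5b => .primitive ((sparseRows 4).permute (.swap 0 1))
  | .c6a => .primitive (sparseRows 5)
  | .c6b => .primitive ((sparseRows 5).permute (.swap 0 1))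
  | .c6c => .primitive ((sparseRows 5).permute (.swap 1 2))
  | .c7a => .primitive (sparseRows 6)
  | .c7b => .primitive ((sparseRows 6).permute (.swap 0 1))
  | .c7c => .primitive ((sparseRows 6).permute (.swap 1 2))
  | .c1_I => .ofTable
      !![unit 1 1 ++ unit 2 2, neg (unit 0 1), neg (unit 0 2);
         neg (unit 2 1), unit 2 2, unit 0 1 ++ neg (unit 1 2);
         [], [], []]
  | .c6_I => .ofTable
      !![unit 1 1, neg (unit 0 1 ++ unit 2 1), unit 0 0 ++ unit 1 1 ++ neg (unit 0 2);
         neg (unit 1 0) ++ unit 1 2, [], [];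
         neg (unit 2 0) ++ unit 2 2, [], []]
  | .c6_II => .ofTable
      !![unit 1 1, [], [];
         neg (unit 1 0), [], [];
         neg (unit 2 0) ++ unit 0 0 ++ unit 1 1, [], []]
  | .c6_III => .ofTable
      !![unit 1 1, [], [];
         neg (unit 1 0 ++ unit 1 2), [], [];
         neg (unit 2 0) ++ unit 0 0 ++ unit 1 1, [], []]
  | .c2_I => .ofTable
      !![unit 1 1 ++ unit 2 2, neg (unit 0 1), neg (unit 0 2);
         [], unit 2 2, neg (unit 1 2);
         [], unit 2 2, neg (unit 2 2)]
  | .c2_II => .ofTable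
      !![unit 1 1 ++ unit 2 2, neg (unit 0 1), neg (unit 0 2);
         [], unit 2 2, unit 2 2;
         [], neg (unit 2 1), neg (unit 2 2)]
  | .c3_I => .ofTable
      !![neg (unit 0 0), neg (unit 0 1), neg (unit 0 2);
         [], neg (unit 0 0 ++ unit 1 1), neg (unit 1 2);
         [], unit 0 0 ++ unit 1 1, unit 0 0 ++ unit 1 1]
  | .c3_II => .ofTable
      !![neg (unit 0 0), neg (unit 0 1), neg (unit 0 2);
         [], neg (unit 0 0 ++ unit 1 1), unit 0 0 ++ unit 1 1;
         [], neg (unit 2 1), unit 0 0 ++ unit 1 1]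
  | .c4_I => .ofTable
      !![[], neg (unit 0 1), neg (unit 0 2);
         [], unit 0 0 ++ unit 2 2, unit 2 2;
         [], neg (unit 2 1), neg (unit 2 2)]
  | .c4_II => .ofTable
      !![[], neg (unit 0 1), neg (unit 0 2);
         [], unit 0 0 ++ unit 2 2, neg (unit 1 2);
         [], unit 2 2, neg (unit 2 2)]
  | .c5_I => .ofTable
      !![unit 1 1 ++ unit 2 2, neg (unit 0 1), neg (unit 0 2);
         [], [], [];
         [], [], []]
  | .c5_II => .ofTable
      !![unit 1 1 ++ unit 2 2, neg (unit 0 1), neg (unit 0 2);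
         [], [], [];
         [], unit 2 2 ++ neg (unit 2 1), []]
  | .c6_IV => .ofTable
      !![[], neg (unit 0 1), neg (unit 0 2);
         [], unit 0 0, neg (unit 1 2) ++ unit 0 0 ++ unit 1 1;
         [], [], []]
  | .c6_V => .ofTable
      !![[], neg (unit 0 1), neg (unit 0 2);
         [], unit 0 0, [];
         [], neg (unit 2 1) ++ unit 0 0 ++ unit 1 1, []]
  | .c6_VI => .ofTable
      !![unit 1 1, neg (unit 0 1), neg (unit 0 2);
         [], [], [];
         [], [], []]
  | .c8_I => .ofTable
      !![neg (unit 0 0), neg (unit 0 1), neg (unit 0 2);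
         [], [], [];
         [], unit 0 0 ++ unit 1 1 ++ neg (unit 2 1), []]

theorem listed_eq_toEnd (c : Case) : listed F c = (model c).toEnd F := by
  cases c with
  | c1a | c1b | c1c | c2a | c2b | c2c | c3a | c3b | c3c | c4a | c4b | c4c | c5a | c5b | c6a | c6b
  | c6c | c7a | c7b | c7c =>
    simp only [model, SparseOp.toEnd_primitive, SparseMat.toMat_permute, toMat_sparseRows]
    rfl
  | _ =>
    rw [model, SparseOp.toEnd_ofTable, listed]
    congr 1
    ext1 i j
    fin_cases i <;> fin_cases j <;>
      simp [SparseMat.toMat_append, SparseMat.toMat_neg, SparseMat.toMat_unit, e11, e12, e13, e21,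
        e22, e23, e31, e32, e33, sub_eq_add_neg, neg_add, add_assoc, -neg_add_rev]

end ListedModel

/-- The labels of the 36 operators in a list, for computations. -/
def allCases : List Case :=
  [.c1a, .c1b, .c1c, .c2a, .c2b, .c2c, .c3a, .c3b, .c3c, .c4a, .c4b, .c4c, .c5a, .c5b, .c6a, .c6b,
    .c6c, .c7a, .c7b, .c7c, .c1_I, .c6_I, .c6_II, .c6_III, .c2_I, .c2_II, .c3_I, .c3_II, .c4_I,
    .c4_II, .c5_I, .c5_II, .c6_IV, .c6_V, .c6_VI, .c8_I]

theorem mem_allCases (c : Case) : c ∈ allCases := by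
  cases c <;> simp [allCases]

theorem isRotaBaxter_model : ∀ c ∈ allCases, (model c).isRotaBaxter := by
  decide +kernel

section Separation

open SubspaceExpr Letter in
/-- Expressions whose vanishing separates the orbits of the listed operators. They were found by a
computer search. -/
def tests : List (SubspaceExpr Letter) :=
  let P := op .op
  let Q := op .opSucc
  let p := op .adj
  let q := op .adjSucc
  let l := [Q (Q one),
    P (P (P (q (q (p one))))),
    p (p (p (Q (Q (P one))))),
    lie (q (Q top)) (P (p top)),
    triple (Q (P one)) (q top) (Q (P one)),
    triple (P (P top)) (q (p top)) (P (P top)),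
    triple (p (p top)) (Q (P top)) (p (p top)),
    triple (p (p top)) (Q (Q top)) (p (p top)),
    triple (Q (Q top)) (p (p top)) (Q (Q top))]
  l ++ l.map (relabel swap)

/-- The generators of the subspace that the expression `e` attaches to a listed operator. -/
def caseGens (c : Case) (e : SubspaceExpr Letter) : List (SparseMat (Fin 3)) :=
  e.gens (model c).letter

theorem pairwise_exactlyOneVanishes : allCases.Pairwise fun c d =>
    (∃ e ∈ tests, ExactlyOneVanishes (caseGens d e) (caseGens c e)) ∧
      ∃ e ∈ tests, ExactlyOneVanishes (caseGens d e) (caseGens c (e.relabel .swap)) := by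
  decide +kernel

variable (F : Type*) [Field F]

theorem vanishes_listed_iff (c : Case) (e : SubspaceExpr Letter) :
    Vanishes (listed F c) e ↔ spanOf F (caseGens c e) = ⊥ := by
  rw [caseGens, spanOf_gens (SparseOp.toEnd_letter F (model c)), listed_eq_toEnd, Vanishes]

theorem pairwise_orbit_listed_ne :
    allCases.Pairwise fun c d => orbit (listed F c) ≠ orbit (listed F d) := by
  refine pairwise_exactlyOneVanishes.imp ?_
  rintro c d ⟨⟨e, -, he⟩, e', -, he'⟩ h
  rcases vanishes_of_orbit_eq h with hv | hv
  · exact he.not_spanOf_eq_bot_iff (k := F) (by simpa only [vanishes_listed_iff] using hv e)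
  · exact he'.not_spanOf_eq_bot_iff (k := F) (by simpa only [vanishes_listed_iff] using hv e')

theorem orbit_listed_injective : Function.Injective fun c => orbit (listed F c) := by
  intro c d h
  by_contra hcd
  have symm : Std.Symm fun c d => orbit (listed F c) ≠ orbit (listed F d) := ⟨fun _ _ => Ne.symm⟩
  exact (pairwise_orbit_listed_ne F).forall (mem_allCases c) (mem_allCases d) hcd h

end Separation

end RotaBaxter

theorem corollary2_general (F : Type*) [Field F] :
    (∀ c : RotaBaxter.Case, RotaBaxter.IsRotaBaxter (1 : F) (RotaBaxter.listed F c)) ∧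
    (∀ c d : RotaBaxter.Case, c ≠ d →
      RotaBaxter.orbit (RotaBaxter.listed F c) ≠ RotaBaxter.orbit (RotaBaxter.listed F d)) := by
  refine ⟨fun c => ?_, fun c d hcd h => ?_⟩
  · rw [RotaBaxter.listed_eq_toEnd]
    exact RotaBaxter.SparseOp.isRotaBaxter_toEnd
      (RotaBaxter.isRotaBaxter_model c (RotaBaxter.mem_allCases c))
  · exact hcd (RotaBaxter.orbit_listed_injective F h)

theorem corollary2 (F : Type*) [Field F] [IsAlgClosed F] [CharZero F] :
    (∀ c : RotaBaxter.Case, RotaBaxter.IsRotaBaxter (1 : F) (RotaBaxter.listed F c)) ∧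
    (∀ c d : RotaBaxter.Case, c ≠ d →
      RotaBaxter.orbit (RotaBaxter.listed F c) ≠ RotaBaxter.orbit (RotaBaxter.listed F d)) :=
  corollary2_general F
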